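/- Rings are associative with $1$ and modules are unital. A ring $R$ is von Neumann regular if for every $a\in R$ there is $x\in R$ with $axa=a$. For a left or right $R$-module $P$ let $L(P)$ be the set of finitely generated submodules of $P$, ordered by inclusion. A partially ordered set is complete if each of its subsets has a supremum and an infimum. It is upper continuous if it is complete and $a\wedge\bigvee_i b_i=\bigvee_i (a\wedge b_i)$ for every element $a$ and every linearly ordered subset $\{b_i\}$; it is lower continuous if it is complete and $a\vee\bigwedge_i b_i=\bigwedge_i (a\vee b_i)$ for all such $a$ and $\{b_i\}$. The ring $R$ is right (left) self-injective if it is injective as a right (left) module over itself. It is right (left) $\pi$-coherent if for every set $I$ every finitely generated right (left) submodule of $R^I$ is finitely presented. Write $R_R^n$ and ${}_RR^n$ for $R^n$ regarded as a right, respectively left, $R$-module. Proposition. Let $R$ be a von Neumann regular ring. (a) The following are equivalent: (i) $R$ is right self-injective; (ii) $L(R_R^n)$ is upper continuous for every $n\in\mathbb N$; (iii) $L(R_R^2)$ is upper continuous; (iv) $L(R_R)$ is upper continuous and $L(R_R^2)$ is complete. (b) The following are equivalent: (i) $R$ is left self-injective; (ii) $L({}_RR^n)$ is upper continuous for every $n\in\mathbb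 N$; (iii) $L({}_RR^2)$ is upper continuous; (iv) $L({}_RR)$ is upper continuous and $L({}_RR^2)$ is complete; (ii$'$) $L(R_R^n)$ is lower continuous for every $n\in\mathbb N$; (iii$'$) $L(R_R^2)$ is lower continuous; (iv$'$) $L(R_R)$ is lower continuous and $L(R_R^2)$ is complete. (c) If $R$ is left or right self-injective, then $R$ is both left and right $\pi$-coherent. -/

import Mathlib

universe u v

/-- A ring is von Neumann regular if every element `a` has a quasi-inverse `x`: `a x a = a`. -/
def IsVNRegular (R : Type u) [Ring R] : Prop :=
  ∀ a : R, ∃ x : R, a * x * a = a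

/-- `L(P)`: the finitely generated `A`-submodules of the `A`-module `P`, ordered by inclusion. -/
abbrev FGLattice (A : Type*) (P : Type*) [Ring A] [AddCommGroup P] [Module A P] : Type _ :=
  {N : Submodule A P // N.FG}

/-- A partially ordered set is a complete lattice: every subset has a supremum and an infimum. -/
def IsCompleteOrder (α : Type*) [PartialOrder α] : Prop :=
  ∀ S : Set α, (∃ s, IsLUB S s) ∧ ∃ t, IsGLB S t

/-- Upper continuity: the order is a complete lattice, and `a ⊓ ⨆ C = ⨆ c ∈ C, a ⊓ c` for every
element `a` and every linearly ordered subset `C`. -/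
structure IsUpperContinuous (α : Type*) [PartialOrder α] : Prop where
  complete : IsCompleteOrder α
  inf_sup : ∀ (a : α) (C : Set α), IsChain (· ≤ ·) C →
    ∀ s m : α, IsLUB C s → IsGLB {a, s} m → IsLUB {x | ∃ c ∈ C, IsGLB {a, c} x} m

/-- Lower continuity: the order is a complete lattice, and `a ⊔ ⨅ C = ⨅ c ∈ C, a ⊔ c` for every
element `a` and every linearly ordered subset `C`. -/
structure IsLowerContinuous (α : Type*) [PartialOrder α] : Prop where
  complete : IsCompleteOrder α
  sup_inf : ∀ (a : α) (C : Set α), IsChain (· ≤ ·) C →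
    ∀ t j : α, IsGLB C t → IsLUB {a, t} j → IsGLB {x | ∃ c ∈ C, IsLUB {a, c} x} j

/-- `R` is injective as a right module over itself; right `R`-modules are modules over `Rᵐᵒᵖ`. -/
def IsRightSelfInjective (R : Type u) [Ring R] : Prop :=
  Module.Injective Rᵐᵒᵖ R

/-- `R` is injective as a left module over itself. -/
def IsLeftSelfInjective (R : Type u) [Ring R] : Prop :=
  Module.Injective R R

/-- For every index set `I`, finitely generated left submodules of `R^I` are finitely presented. -/
def IsLeftPiCoherent (R : Type u) [Ring R] : Prop :=
  ∀ (I : Type v) (N : Submodule R (I → R)), N.FG → Module.FinitePresentation R N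

/-- For every index set `I`, finitely generated right submodules of `R^I` are finitely presented. -/
def IsRightPiCoherent (R : Type u) [Ring R] : Prop :=
  ∀ (I : Type v) (N : Submodule Rᵐᵒᵖ (I → R)), N.FG → Module.FinitePresentation Rᵐᵒᵖ N

/-! Over a von Neumann regular ring, free modules of finite rank are regular modules: finitely
generated submodules are direct summands closed under intersection, and kernels of maps between such
modules are finitely generated.

If `A` is self-injective, every submodule of `A^n` is essential in a finitely generated one
(`exists_fg_essential`), and such hulls yield completeness and upper continuity. Conversely, upper
continuity says that passing to the closure `fgClosure` creates no new intersections
(`disjoint_fgClosure`). Closing the graph of `g : J → A` in `A × A` then gives the graph of an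
extension, which is Baer's criterion. If only `L(A)` is upper continuous and `L(A²)` is complete,
injective `g` are extended first; the general case splits `J`, up to an essential submodule, as `ker
g ⊕ C`.

Annihilators under the dot product exchange left and right and reverse order, so lower continuity on
the right is upper continuity on the left. Completeness is self-dual, hence two-sided, and it makes
kernels of maps `A^n → A^I` finitely generated, which is π-coherence. -/

/-- A module is (Zelmanowitz) regular if each `v` is fixed by `φ v` for some linear form `φ`. -/
def IsRegularModule (A M : Type*) [Ring A] [AddCommGroup M] [Module A M] : Prop :=
  ∀ v : M, ∃ φ : M →ₗ[A] A, φ v • v = v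

/-! ### Regular modules: projections, kernels, essential submodules -/

section RegularModule

variable {A M P : Type*} [Ring A] [AddCommGroup M] [Module A M] [AddCommGroup P] [Module A P]

theorem IsVNRegular.isRegularModule (h : IsVNRegular A) :
    IsRegularModule A A := by
  intro a
  obtain ⟨x, hx⟩ := h a
  exact ⟨LinearMap.toSpanSingleton A A x, by simpa using hx⟩

theorem IsRegularModule.of_injective (hP : IsRegularModule A P) (i : M →ₗ[A] P)
    (hi : Function.Injective i) : IsRegularModule A M := by
  intro v
  obtain ⟨φ, hφ⟩ := hP (i v)
  exact ⟨φ ∘ₗ i, hi (by simpa using hφ)⟩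

/-- `φ` handles `p`, and `ψ` handles what remains of `q`. The right factor `1 - φ p` kills `p`, so
the correction leaves the first coordinate alone. -/
theorem IsRegularModule.prod (hM : IsRegularModule A M) (hP : IsRegularModule A P) :
    IsRegularModule A (M × P) := by
  rintro ⟨p, q⟩
  obtain ⟨φ, hφ⟩ := hM p
  obtain ⟨ψ, hψ⟩ := hP (q - φ p • q)
  refine ⟨φ ∘ₗ LinearMap.fst A M P +
    LinearMap.toSpanSingleton A A (1 - φ p) ∘ₗ
      (ψ ∘ₗ LinearMap.snd A M P -
        LinearMap.toSpanSingleton A A (ψ q) ∘ₗ φ ∘ₗ LinearMap.fst A M P), ?_⟩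
  have h1 : (1 - φ p) • p = 0 := by rw [sub_smul, one_smul, hφ, sub_self]
  have h2 : (1 - φ p) • q = q - φ p • q := by rw [sub_smul, one_smul]
  ext
  · simp [add_smul, mul_smul, h1, hφ]
  · simp only [LinearMap.add_apply, LinearMap.comp_apply, LinearMap.sub_apply,
      LinearMap.fst_apply, LinearMap.snd_apply, LinearMap.toSpanSingleton_apply, smul_eq_mul,
      add_smul, mul_smul, Prod.snd_add, Prod.smul_snd, h2]
    rw [← smul_eq_mul, ← map_smul, ← map_sub, hψ, add_sub_cancel]

theorem IsRegularModule.pi_fin (hM : IsRegularModule A M) :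
    ∀ n : ℕ, IsRegularModule A (Fin n → M)
  | 0 => fun v => ⟨0, Subsingleton.elim _ _⟩
  | n + 1 => by
    refine (hM.prod (IsRegularModule.pi_fin hM n)).of_injective
      ((LinearMap.proj 0).prod (LinearMap.funLeft A M Fin.succ)) fun x y h => ?_
    have h' := Prod.ext_iff.1 h
    funext i
    refine Fin.cases h'.1 (fun j => congrFun h'.2 j) i

/-- Finitely generated submodules of a regular module are images of projections. -/
theorem IsRegularModule.exists_proj (hM : IsRegularModule A M) {N : Submodule A M}
    (hN : N.FG) : ∃ p : M →ₗ[A] M, (∀ x, p x ∈ N) ∧ ∀ x ∈ N, p x = x := by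
  induction N, hN using Submodule.fg_sup_span_induction with
  | bot => exact ⟨0, by simp, by simp⟩
  | sup N v hN ih =>
    obtain ⟨p, hp, hpN⟩ := ih
    -- Modulo `N` the new generator is `v - p v`; its form `φ`, composed with `id - p`, vanishes on
    -- `N`.
    obtain ⟨φ, hφ⟩ := hM (v - p v)
    refine ⟨p + (LinearMap.toSpanSingleton A M (v - p v)) ∘ₗ φ ∘ₗ (LinearMap.id - p),
      fun x => ?_, fun x hx => ?_⟩
    · have hv : v - p v ∈ N ⊔ A ∙ v := sub_mem
        (Submodule.mem_sup_right (Submodule.mem_span_singleton_self v))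
        (Submodule.mem_sup_left (hp v))
      exact add_mem (Submodule.mem_sup_left (hp x)) (Submodule.smul_mem _ _ hv)
    · obtain ⟨y, hy, z, hz, rfl⟩ := Submodule.mem_sup.1 hx
      obtain ⟨r, rfl⟩ := Submodule.mem_span_singleton.1 hz
      simp only [LinearMap.add_apply, LinearMap.comp_apply, LinearMap.sub_apply, LinearMap.id_apply,
        LinearMap.toSpanSingleton_apply, map_add, map_smul]
      rw [hφ, hpN y hy, sub_self, map_zero, zero_smul, add_zero, add_sub_cancel]

theorem IsRegularModule.exists_isCompl (hM : IsRegularModule A M) {N : Submodule A M}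
    (hN : N.FG) : ∃ C, IsCompl N C := by
  obtain ⟨p, hp, hpN⟩ := hM.exists_proj hN
  exact ⟨_, LinearMap.isCompl_of_proj (f := p.codRestrict N hp)
    fun x => Subtype.ext (hpN x x.2)⟩

theorem IsRegularModule.exists_proj_of_disjoint (hM : IsRegularModule A M) {a b : Submodule A M}
    (ha : a.FG) (hb : b.FG) (hab : Disjoint a b) :
    ∃ p : M →ₗ[A] M, (∀ x ∈ a, p x = x) ∧ ∀ x ∈ b, p x = 0 := by
  obtain ⟨C, hC⟩ := hM.exists_isCompl (ha.sup hb)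
  have h : IsCompl a (b ⊔ C) :=
    ⟨hab.disjoint_sup_right_of_disjoint_sup_left hC.disjoint,
      codisjoint_iff.2 (by rw [← sup_assoc]; exact hC.sup_eq_top)⟩
  exact ⟨a.projection _ h, fun x hx => Submodule.projection_apply_of_mem_left h hx,
    fun x hx => (Submodule.projection_apply_eq_zero_iff h).2 (Submodule.mem_sup_left hx)⟩

/-- Adjoining `v` to `N` adds one generator to the kernel. With `w = g v - p (g v)`, a relation `g y
+ r • g v = 0` forces `r • w = 0`, hence `r = r * (1 - φ w)`; and `(1 - φ w) • v` has the same image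
as some `n ∈ N`. -/
theorem IsRegularModule.fg_inf_ker (hP : IsRegularModule A P) (g : M →ₗ[A] P)
    {N : Submodule A M} (hN : N.FG) : (N ⊓ LinearMap.ker g).FG := by
  induction N, hN using Submodule.fg_sup_span_induction with
  | bot => simpa using Submodule.fg_bot
  | sup N v hN ih =>
    obtain ⟨p, hp, hpN⟩ := hP.exists_proj (hN.map g)
    obtain ⟨φ, hφ⟩ := hP (g v - p (g v))
    obtain ⟨n, hn, hgn⟩ : g ((1 - φ (g v - p (g v))) • v) ∈ N.map g := by
      have : g ((1 - φ (g v - p (g v))) • v) = p (g ((1 - φ (g v - p (g v))) • v)) := by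
        rw [← sub_eq_zero, map_smul, map_smul, ← smul_sub, sub_smul, one_smul, hφ, sub_self]
      rw [this]
      exact hp _
    have key : (N ⊔ A ∙ v) ⊓ LinearMap.ker g =
        N ⊓ LinearMap.ker g ⊔ A ∙ ((1 - φ (g v - p (g v))) • v - n) := by
      apply le_antisymm
      · rintro x ⟨hx, hgx⟩
        obtain ⟨y, hy, z, hz, rfl⟩ := Submodule.mem_sup.1 hx
        obtain ⟨r, rfl⟩ := Submodule.mem_span_singleton.1 hz
        have h0 : g y + r • g v = 0 := by simpa using hgx
        have hr : r • (g v - p (g v)) = 0 := by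
          have h1 : p (g y) = g y := hpN _ (Submodule.mem_map_of_mem hy)
          have h2 : p (g y) + r • p (g v) = 0 := by rw [← map_smul, ← map_add, h0, map_zero]
          rw [smul_sub, sub_eq_zero]
          rw [h1] at h2
          exact add_left_cancel (h0.trans h2.symm)
        have hr' : r * φ (g v - p (g v)) = 0 := by
          rw [← smul_eq_mul, ← map_smul, hr, map_zero]
        have hrv : r • (1 - φ (g v - p (g v))) • v = r • v := by
          rw [← mul_smul, mul_sub, hr', mul_one, sub_zero]
        refine Submodule.mem_sup.2 ⟨y + r • n, ⟨add_mem hy (N.smul_mem r hn), ?_⟩,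
          r • ((1 - φ (g v - p (g v))) • v - n), Submodule.mem_span_singleton.2 ⟨r, rfl⟩, ?_⟩
        · rw [SetLike.mem_coe, LinearMap.mem_ker, map_add, map_smul, hgn, ← map_smul, hrv,
            map_smul, h0]
        · rw [smul_sub, hrv]; abel
      · refine sup_le (inf_le_inf_right _ le_sup_left) ?_
        rw [Submodule.span_singleton_le_iff_mem]
        refine ⟨sub_mem (Submodule.mem_sup_right (Submodule.smul_mem _ _
          (Submodule.mem_span_singleton_self v))) (Submodule.mem_sup_left hn), ?_⟩
        rw [SetLike.mem_coe, LinearMap.mem_ker, map_sub, hgn, sub_self]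
    rw [key]
    exact ih.sup (Submodule.fg_span_singleton _)

theorem IsRegularModule.fg_ker [Module.Finite A M] (hP : IsRegularModule A P) (g : M →ₗ[A] P) :
    (LinearMap.ker g).FG := by
  simpa using hP.fg_inf_ker g Module.Finite.fg_top

theorem IsRegularModule.fg_inf (hM : IsRegularModule A M) {a b : Submodule A M}
    (ha : a.FG) (hb : b.FG) : (a ⊓ b).FG := by
  -- `b` is the kernel of `id - p`.
  obtain ⟨p, hp, hpb⟩ := hM.exists_proj hb
  convert hM.fg_inf_ker (LinearMap.id - p) ha using 2
  ext x
  simp only [LinearMap.mem_ker, LinearMap.sub_apply, LinearMap.id_apply, sub_eq_zero]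
  exact ⟨fun hx => (hpb x hx).symm, fun hx => hx ▸ hp x⟩

/-- If `U` meets every nonzero submodule of the finitely generated `E`, then `E` lies in every
finitely generated submodule containing `U`. -/
theorem IsRegularModule.le_of_essential (hM : IsRegularModule A M) {U E K : Submodule A M}
    (hE : E.FG) (hK : K.FG) (hU : ∀ X ≤ E, Disjoint X U → X = ⊥) (hUK : E ⊓ U ≤ K) : E ≤ K := by
  obtain ⟨C, hC⟩ := hM.exists_isCompl (hM.fg_inf hE hK)
  have h : C ⊓ E = ⊥ := by
    refine hU _ inf_le_right (disjoint_iff_inf_le.2 ?_)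
    refine le_trans ?_ hC.disjoint.le_bot
    exact le_inf (le_inf (inf_le_left.trans inf_le_right)
      (le_trans (le_inf (inf_le_left.trans inf_le_right) inf_le_right) hUK))
      (inf_le_left.trans inf_le_left)
  -- Modular law: `E` splits as `E ⊓ K` plus a part that misses `U`, which is zero.
  have h2 : E ⊓ K ⊔ C ⊓ E = E := by
    rw [← sup_inf_assoc_of_le C (inf_le_left : E ⊓ K ≤ E), hC.sup_eq_top, top_inf_eq]
  rw [h, sup_bot_eq] at h2
  exact h2 ▸ inf_le_right

/-- A linear map into a regular module that vanishes on an essential submodule is zero. -/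
theorem IsRegularModule.eq_zero_of_essential (hP : IsRegularModule A P) (d : M →ₗ[A] P)
    {W : Submodule A M} (hW : ∀ Y, Disjoint Y W → Y = ⊥) (hd : ∀ x ∈ W, d x = 0) : d = 0 := by
  ext x
  obtain ⟨φ, hφ⟩ := hP (d x)
  have h : A ∙ (φ (d x) • x) = ⊥ := by
    refine hW _ (Submodule.disjoint_def.2 fun y hy hyW => ?_)
    obtain ⟨r, rfl⟩ := Submodule.mem_span_singleton.1 hy
    have h0 := hd _ hyW
    rw [map_smul, map_smul, hφ] at h0
    rw [← mul_smul, ← smul_eq_mul r, ← map_smul, h0, map_zero, zero_smul]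
  rw [Submodule.span_singleton_eq_bot] at h
  rw [← hφ, ← map_smul, h, map_zero, LinearMap.zero_apply]

end RegularModule

/-- Every submodule has a maximal disjoint submodule. -/
theorem Submodule.exists_maximal_disjoint {A M : Type*} [Ring A] [AddCommGroup M] [Module A M]
    (U : Submodule A M) : ∃ C, Maximal (Disjoint U) C := by
  obtain ⟨C, hC⟩ := zorn_le₀ {C : Submodule A M | Disjoint U C} fun c hc hch => by
    rcases c.eq_empty_or_nonempty with rfl | hne
    · exact ⟨⊥, disjoint_bot_right, by simp⟩
    · refine ⟨sSup c, ?_, fun _ => le_sSup⟩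
      rw [Set.mem_ofPred_eq, Submodule.disjoint_def]
      intro x hx hxc
      obtain ⟨y, hy, hxy⟩ := (Submodule.mem_sSup_of_directed hne hch.directedOn).1 hxc
      exact Submodule.disjoint_def.1 (hc hy) x hx hxy
  exact ⟨C, hC⟩

theorem Submodule.eq_bot_of_maximal_disjoint {A M : Type*} [Ring A] [AddCommGroup M] [Module A M]
    {U C : Submodule A M} (hC : Maximal (Disjoint U) C) (Y : Submodule A M)
    (hY : Disjoint Y (U ⊔ C)) : Y = ⊥ := by
  have h : Disjoint U (C ⊔ Y) :=
    hC.prop.disjoint_sup_right_of_disjoint_sup_left hY.symm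
  have := hC.le_of_ge h le_sup_left
  exact le_bot_iff.1 (hY le_rfl ((le_sup_right.trans this).trans le_sup_right))

/-! ### Transport of order conditions along isomorphisms and duality -/

section Order

variable {α β : Type*} [PartialOrder α] [PartialOrder β]

theorem IsCompleteOrder.congr (e : α ≃o β) (h : IsCompleteOrder α) : IsCompleteOrder β := by
  intro S
  obtain ⟨⟨s, hs⟩, t, ht⟩ := h (e ⁻¹' S)
  have hS : e '' (e ⁻¹' S) = S := e.surjective.image_preimage S
  exact ⟨⟨e s, hS ▸ e.isLUB_image'.2 hs⟩, e t, hS ▸ e.isGLB_image'.2 ht⟩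

theorem IsCompleteOrder.dual (h : IsCompleteOrder α) : IsCompleteOrder αᵒᵈ := fun S =>
  ⟨(h (OrderDual.toDual ⁻¹' S)).2, (h (OrderDual.toDual ⁻¹' S)).1⟩

theorem OrderIso.image_symm_insert (e : α ≃o β) (a c : β) :
    e '' {e.symm a, e.symm c} = {a, c} := by simp [Set.image_pair]

theorem IsUpperContinuous.congr (e : α ≃o β) (h : IsUpperContinuous α) : IsUpperContinuous β := by
  refine ⟨h.complete.congr e, fun a C hC s m hs hm => ?_⟩
  have hC' : IsChain (· ≤ ·) (e.symm '' C) := e.symm.monotone.isChain_image hC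
  have := h.inf_sup (e.symm a) (e.symm '' C) hC' (e.symm s) (e.symm m)
    (e.symm.isLUB_image'.2 hs) (by
      rw [← Set.image_pair]; exact e.symm.isGLB_image'.2 hm)
  have h2 := e.isLUB_image'.2 this
  rw [e.apply_symm_apply] at h2
  convert h2 using 1
  ext x
  simp only [Set.mem_ofPred_eq, Set.mem_image, exists_exists_and_eq_and]
  constructor
  · rintro ⟨c, hc, hx⟩
    exact ⟨e.symm x, ⟨c, hc, by rw [← Set.image_pair]; exact e.symm.isGLB_image'.2 hx⟩, by simp⟩
  · rintro ⟨y, ⟨c, hc, hy⟩, rfl⟩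
    refine ⟨c, hc, ?_⟩
    rw [← e.image_symm_insert]
    exact e.isGLB_image'.2 hy

theorem isLowerContinuous_orderDual : IsLowerContinuous αᵒᵈ ↔ IsUpperContinuous α :=
  ⟨fun h => ⟨h.complete.dual, fun a C hC s m hs hm =>
      h.sup_inf (OrderDual.toDual a) (OrderDual.ofDual ⁻¹' C) hC.symm s m hs hm⟩,
    fun h => ⟨h.complete.dual, fun a C hC s m hs hm =>
      h.inf_sup (OrderDual.ofDual a) (OrderDual.toDual ⁻¹' C) hC.symm s m hs hm⟩⟩

theorem IsLowerContinuous.congr (e : α ≃o β) (h : IsLowerContinuous α) : IsLowerContinuous β :=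
  (isLowerContinuous_orderDual (α := βᵒᵈ)).2 <|
    IsUpperContinuous.congr e.dual <| (isLowerContinuous_orderDual (α := αᵒᵈ)).1 h

end Order

/-! ### Continuity of the lattice of finitely generated submodules -/

section Lattice

variable {A M P : Type*} [Ring A] [AddCommGroup M] [Module A M] [AddCommGroup P] [Module A P]

/-- Isomorphic modules have isomorphic posets of finitely generated submodules. -/
def FGLattice.congr (e : M ≃ₗ[A] P) : FGLattice A M ≃o FGLattice A P where
  toFun N := ⟨N.1.map (e : M →ₗ[A] P), N.2.map _⟩
  invFun N := ⟨N.1.map (e.symm : P →ₗ[A] M), N.2.map _⟩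
  left_inv N := Subtype.ext <| by ext; simp
  right_inv N := Subtype.ext <| by ext; simp
  map_rel_iff' := by
    intro a b
    exact Submodule.map_le_map_iff_of_injective e.injective _ _

/-- The intersection of all finitely generated submodules containing `U`. -/
def Submodule.fgClosure (U : Submodule A M) : Submodule A M := sInf {N | N.FG ∧ U ≤ N}

theorem Submodule.le_fgClosure (U : Submodule A M) : U ≤ U.fgClosure := le_sInf fun _ h => h.2

theorem Submodule.fgClosure_le {U N : Submodule A M} (hN : N.FG) (h : U ≤ N) : U.fgClosure ≤ N :=
  sInf_le ⟨hN, h⟩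

theorem Submodule.fgClosure_mono {U V : Submodule A M} (h : U ≤ V) :
    U.fgClosure ≤ V.fgClosure := sInf_le_sInf fun _ hN => ⟨hN.1, h.trans hN.2⟩

/-- Every cyclic submodule of the intersection is a lower bound, so an order infimum must be the
intersection itself. Suprema are infima of upper bounds. -/
theorem isCompleteOrder_fgLattice_iff :
    IsCompleteOrder (FGLattice A M) ↔
      ∀ S : Set (Submodule A M), (∀ N ∈ S, N.FG) → (sInf S).FG := by
  constructor
  · intro h S hS
    obtain ⟨t, ht⟩ := (h (Subtype.val ⁻¹' S)).2
    suffices sInf S = t.1 from this ▸ t.2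
    apply le_antisymm
    · intro x hx
      have hlb : (⟨A ∙ x, Submodule.fg_span_singleton x⟩ : FGLattice A M) ≤ t := ht.2 fun N hN =>
        ((Submodule.span_singleton_le_iff_mem _ _).2 (Submodule.mem_sInf.1 hx _ hN) : A ∙ x ≤ N.1)
      exact hlb (Submodule.mem_span_singleton_self x)
    · exact le_sInf fun N hN => ht.1 (show (⟨N, hS N hN⟩ : FGLattice A M) ∈ Subtype.val ⁻¹' S from hN)
  · intro h
    have key (S : Set (FGLattice A M)) : ∃ t, IsGLB S t := by
      have hS : (sInf (Subtype.val '' S)).FG := h _ (by rintro _ ⟨N, -, rfl⟩; exact N.2)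
      refine ⟨⟨_, hS⟩, fun N hN => (sInf_le ⟨N, hN, rfl⟩ : sInf (Subtype.val '' S) ≤ N.1),
        fun N hN => (?_ : N.1 ≤ sInf (Subtype.val '' S))⟩
      · refine le_sInf ?_
        rintro _ ⟨K, hK, rfl⟩
        exact hN hK
    intro S
    obtain ⟨t, ht⟩ := key (upperBounds S)
    exact ⟨⟨t, isGLB_upperBounds.1 ht⟩, key S⟩

theorem Submodule.fg_fgClosure (h : IsCompleteOrder (FGLattice A M)) (U : Submodule A M) :
    U.fgClosure.FG :=
  isCompleteOrder_fgLattice_iff.1 h _ fun _ hN => hN.1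

theorem IsRegularModule.isGLB_pair_iff (hM : IsRegularModule A M) {a b m : FGLattice A M} :
    IsGLB {a, b} m ↔ m.1 = a.1 ⊓ b.1 := by
  have hs : IsGLB {a, b} (⟨_, hM.fg_inf a.2 b.2⟩ : FGLattice A M) := by
    constructor
    · rintro x (hx | hx) <;> rw [hx]
      · exact (inf_le_left : a.1 ⊓ b.1 ≤ a.1)
      · exact (inf_le_right : a.1 ⊓ b.1 ≤ b.1)
    · intro N hN
      exact (le_inf (hN (Set.mem_insert a {b})) (hN (Set.mem_insert_of_mem a rfl)) :
        N.1 ≤ a.1 ⊓ b.1)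
  exact ⟨fun h' => congrArg Subtype.val (h'.unique hs), fun h' => by
    rw [show m = ⟨_, hM.fg_inf a.2 b.2⟩ from Subtype.ext h']; exact hs⟩

/-- Zorn's lemma applies to the `K ≤ U` having the desired property: upper continuity handles unions
of chains. A maximal `K` is essential in `U`, since a disjoint cyclic submodule could be adjoined,
so `U` lies in the closure of `K`. -/
theorem IsRegularModule.disjoint_fgClosure (hM : IsRegularModule A M)
    (h : IsUpperContinuous (FGLattice A M)) (U : Submodule A M) {a : Submodule A M} (ha : a.FG)
    (hU : Disjoint a U) : Disjoint a U.fgClosure := by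
  obtain ⟨K, hK⟩ := zorn_le₀ {K : Submodule A M | K ≤ U ∧
      ∀ a : Submodule A M, a.FG → Disjoint a K → Disjoint a K.fgClosure} fun c hc hch => by
    refine ⟨sSup c, ⟨sSup_le fun K hK => (hc hK).1, fun a ha hac => ?_⟩, fun _ => le_sSup⟩
    let f : Submodule A M → FGLattice A M := fun K => ⟨_, Submodule.fg_fgClosure h.complete K⟩
    have hf : Monotone f := fun K L hKL => Submodule.fgClosure_mono hKL
    have hC : IsChain (· ≤ ·) (f '' c) := hf.isChain_image hch
    have hs : IsLUB (f '' c) (f (sSup c)) := by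
      refine ⟨?_, fun N hN => Submodule.fgClosure_le N.2 (sSup_le fun K hK => ?_)⟩
      · rintro _ ⟨K, hK, rfl⟩
        exact hf (le_sSup hK)
      · exact K.le_fgClosure.trans (hN ⟨K, hK, rfl⟩ : f K ≤ N)
    have := h.inf_sup ⟨a, ha⟩ _ hC _ ⟨_, hM.fg_inf ha (f (sSup c)).2⟩ hs (hM.isGLB_pair_iff.2 rfl)
    have hle : _ ≤ (⟨⊥, Submodule.fg_bot⟩ : FGLattice A M) := this.2 (by
      rintro x ⟨_, ⟨K, hK, rfl⟩, hx⟩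
      rw [hM.isGLB_pair_iff] at hx
      change x.1 ≤ ⊥
      rw [hx]
      exact ((hc hK).2 a ha (hac.mono_right (le_sSup hK))).le_bot)
    exact disjoint_iff_inf_le.2 hle
  obtain ⟨⟨hKU, hKd⟩, hmax⟩ := hK
  have hess (x : M) (hx : x ∈ U) (hd : Disjoint (A ∙ x) K) : x = 0 := by
    have hKx : K ⊔ A ∙ x ≤ K := by
      refine hmax ⟨sup_le hKU ((Submodule.span_singleton_le_iff_mem _ _).2 hx),
        fun b hb hbd => ?_⟩ le_sup_left
      have h1 : Disjoint (A ∙ x ⊔ b) K := by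
        have := hd.symm.disjoint_sup_right_of_disjoint_sup_left hbd.symm
        exact this.symm
      have h2 := hKd _ ((Submodule.fg_span_singleton x).sup hb) h1
      have h3 : Disjoint b (A ∙ x) := hbd.mono_right le_sup_right
      have h4 : Disjoint b (A ∙ x ⊔ K.fgClosure) := 
        h3.disjoint_sup_right_of_disjoint_sup_left (sup_comm b _ ▸ h2)
      refine h4.mono_right (Submodule.fgClosure_le
        ((Submodule.fg_span_singleton x).sup (Submodule.fg_fgClosure h.complete K)) ?_)
      exact sup_le (K.le_fgClosure.trans le_sup_right) le_sup_left
    have := hd le_rfl (le_sup_right.trans hKx)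
    simpa using this
  have hUK : U ≤ K.fgClosure := by
    intro x hx
    have := hM.le_of_essential (U := K) (Submodule.fg_span_singleton x)
      (Submodule.fg_fgClosure h.complete K) (fun X hX hXK => ?_)
      (inf_le_right.trans K.le_fgClosure)
    · exact this (Submodule.mem_span_singleton_self x)
    · refine (Submodule.eq_bot_iff _).2 fun y hy => hess y
        ((Submodule.span_singleton_le_iff_mem _ _).2 hx (hX hy))
        (hXK.mono_left ((Submodule.span_singleton_le_iff_mem _ _).2 hy))
  exact (hKd a ha (hU.mono_right hKU)).mono_right
    (Submodule.fgClosure_le (Submodule.fg_fgClosure h.complete K) hUK)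

/-- In an injective regular module every submodule is essential in a finitely generated one. -/
theorem IsRegularModule.exists_fg_essential [Small.{v} A] {Q : Type v}
    [AddCommGroup Q] [Module A Q] [Module.Finite A Q] (hM : IsRegularModule A Q)
    [Module.Injective A Q] (U : Submodule A Q) :
    ∃ E : Submodule A Q, E.FG ∧ U ≤ E ∧ ∀ X ≤ E, Disjoint X U → X = ⊥ := by
  obtain ⟨C, hC⟩ := U.exists_maximal_disjoint
  -- Injectivity extends the projection of `U ⊕ C` onto `U`. The extension is idempotent because `U
  -- ⊕ C` is essential, and its range is the required hull.
  obtain ⟨p, hp⟩ := Module.Injective.extension_property A Q (U × C) Q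
    (U.subtype.coprod C.subtype) (by
      rw [← LinearMap.ker_eq_bot, LinearMap.ker_coprod_of_disjoint_range] <;>
      simp [hC.prop]) (U.subtype ∘ₗ LinearMap.fst A U C)
  have hpU (x) (hx : x ∈ U) : p x = x := by simpa using LinearMap.congr_fun hp (⟨x, hx⟩, 0)
  have hpC (x) (hx : x ∈ C) : p x = 0 := by simpa using LinearMap.congr_fun hp (0, ⟨x, hx⟩)
  have hpp : p ∘ₗ p - p = 0 := by
    refine hM.eq_zero_of_essential _ (W := U ⊔ C)
      (fun Y hY => Submodule.eq_bot_of_maximal_disjoint hC Y hY) fun x hx => ?_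
    obtain ⟨y, hy, z, hz, rfl⟩ := Submodule.mem_sup.1 hx
    simp [hpU y hy, hpC z hz]
  have hrange (x) (hx : x ∈ LinearMap.range p) : p x = x := by
    obtain ⟨y, rfl⟩ := hx
    simpa [sub_eq_zero] using LinearMap.congr_fun hpp y
  refine ⟨LinearMap.range p, Submodule.fg_range p, fun x hx => ⟨x, hpU x hx⟩, fun X hX hd => ?_⟩
  -- By maximality of `C`, a submodule `X` of the range missing `U` lies in `C`, where `p` is zero;
  -- but `p` fixes `X`.
  have hCX : C ⊔ X ≤ C := by
    refine hC.le_of_ge (Submodule.disjoint_def.2 fun u hu huCX => ?_) le_sup_left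
    obtain ⟨c, hc, x, hx, rfl⟩ := Submodule.mem_sup.1 huCX
    have h1 := hpU _ hu
    rw [map_add, hpC c hc, zero_add, hrange x (hX hx)] at h1
    rw [← h1] at hu ⊢
    exact Submodule.disjoint_def.1 hd x hx hu
  refine (Submodule.eq_bot_iff _).2 fun x hx => ?_
  rw [← hrange x (hX hx), hpC x (hCX (Submodule.mem_sup_right hx))]

theorem IsRegularModule.isUpperContinuous [Small.{v} A] {Q : Type v}
    [AddCommGroup Q] [Module A Q] [Module.Finite A Q] (hM : IsRegularModule A Q)
    [Module.Injective A Q] : IsUpperContinuous (FGLattice A Q) := by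
  have hcomp : IsCompleteOrder (FGLattice A Q) := by
    refine isCompleteOrder_fgLattice_iff.2 fun S hS => ?_
    obtain ⟨E, hE, hSE, hess⟩ := hM.exists_fg_essential (sInf S)
    -- The hull of the intersection lies in each member of `S`, so it equals the intersection.
    have : E ≤ sInf S := le_sInf fun N hN =>
      hM.le_of_essential hE (hS N hN) hess (inf_le_right.trans (sInf_le hN))
    exact le_antisymm hSE this ▸ hE
  refine ⟨hcomp, fun a C hC s m hs hm => ?_⟩
  rw [hM.isGLB_pair_iff] at hm
  refine ⟨?_, fun t ht => ?_⟩
  · rintro x ⟨c, hc, hx⟩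
    rw [hM.isGLB_pair_iff] at hx
    change x.1 ≤ m.1
    rw [hx, hm]
    exact inf_le_inf_left _ (hs.1 hc)
  -- The union of `C` is essential in `E ≥ s ≥ m`, so it suffices to put `m ⊓ ⋃ C` inside `t`; there
  -- each element lies in a single `c`.
  · obtain ⟨E, hE, hCE, hess⟩ := hM.exists_fg_essential (⨆ c ∈ C, c.1)
    have hsE : s.1 ≤ E := (hs.2 fun c hc =>
      (le_iSup₂ (f := fun (c : FGLattice A Q) (_ : c ∈ C) => c.1) c hc).trans hCE : s ≤ ⟨E, hE⟩)
    refine hM.le_of_essential (U := ⨆ c ∈ C, c.1) m.2 t.2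
      (fun X hX hd => hess X (hX.trans ?_) hd) ?_
    · exact hm ▸ inf_le_right.trans hsE
    · rintro x ⟨hxm, hxC⟩
      rcases C.eq_empty_or_nonempty with rfl | hne
      · have : x = 0 := by simpa using hxC
        exact this ▸ zero_mem _
      · have hdir : DirectedOn (· ≤ ·) (Subtype.val '' C) :=
          ((Subtype.mono_coe _).isChain_image hC).directedOn
        rw [← sSup_image, SetLike.mem_coe, Submodule.mem_sSup_of_directed (hne.image _) hdir] at hxC
        obtain ⟨_, ⟨c, hc, rfl⟩, hxc⟩ := hxC
        have hxa : x ∈ a.1 := (hm ▸ hxm : x ∈ a.1 ⊓ s.1).1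
        have : (⟨_, hM.fg_inf a.2 c.2⟩ : FGLattice A Q) ≤ t :=
          ht ⟨c, hc, hM.isGLB_pair_iff.2 rfl⟩
        exact this ⟨hxa, hxc⟩

end Lattice

/-! ### Baer's criterion via closures of graphs -/

section SelfInjective

variable {A : Type u} [Ring A]

/-- A finitely generated submodule of `A × A` meeting `0 × A` trivially is contained in the graph of
an endomorphism of `A`. -/
theorem IsRegularModule.exists_graph_le (hA : IsRegularModule A A) {N : Submodule A (A × A)}
    (hN : N.FG) (hd : ∀ t, ((0, t) : A × A) ∈ N → t = 0) :
    ∃ h : A →ₗ[A] A, ∀ x ∈ N, h x.1 = x.2 := by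
  have hinj : Function.Injective (LinearMap.fst A A A ∘ₗ N.subtype) := by
    rw [← LinearMap.ker_eq_bot, LinearMap.ker_eq_bot']
    rintro ⟨⟨x, y⟩, hxy⟩ (rfl : x = 0)
    simp [hd y hxy]
  let e := LinearEquiv.ofInjective _ hinj
  -- The first projection of `N` is a direct summand of `A`, so the map it carries extends to all of
  -- `A`.
  obtain ⟨p, hp, hpN⟩ := hA.exists_proj
      (N := LinearMap.range (LinearMap.fst A A A ∘ₗ N.subtype)) (by
    rw [LinearMap.range_comp, Submodule.range_subtype]; exact hN.map _)
  refine ⟨LinearMap.snd A A A ∘ₗ N.subtype ∘ₗ e.symm.toLinearMap ∘ₗ p.codRestrict _ hp,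
    fun x hx => ?_⟩
  have h1 : p.codRestrict _ hp x.1 = e ⟨x, hx⟩ := Subtype.ext (hpN _ ⟨⟨x, hx⟩, rfl⟩)
  simp only [LinearMap.comp_apply, h1, LinearEquiv.coe_coe, e.symm_apply_apply]
  rfl

theorem IsRegularModule.baer_of_isUpperContinuous_prod (hA : IsRegularModule A A)
    (h : IsUpperContinuous (FGLattice A (A × A))) : Module.Baer A A := by
  intro J g
  let G := LinearMap.range (J.subtype.prod g)
  have hd : Disjoint (LinearMap.range (LinearMap.inr A A A)) G.fgClosure := by
    refine (hA.prod hA).disjoint_fgClosure h _ (Submodule.fg_range _) ?_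
    rw [Submodule.disjoint_def]
    rintro _ ⟨t, rfl⟩ ⟨⟨x, hx⟩, hxt⟩
    obtain ⟨h1, h2⟩ := Prod.ext_iff.1 hxt
    have hx0 : (⟨x, hx⟩ : J) = 0 := Subtype.ext h1
    have ht : g ⟨x, hx⟩ = t := h2
    rw [← ht, hx0, map_zero, map_zero]
  obtain ⟨f, hf⟩ := hA.exists_graph_le (G.fg_fgClosure h.complete) fun t ht => by
    simpa using Submodule.disjoint_def.1 hd _ ⟨t, rfl⟩ ht
  exact ⟨f, fun x hx => hf _ (G.le_fgClosure ⟨⟨x, hx⟩, rfl⟩)⟩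

/-- Extension of an injective linear map defined on a left ideal. -/
theorem IsRegularModule.exists_extension_of_injective (hA : IsRegularModule A A)
    (h : IsUpperContinuous (FGLattice A A)) (h2 : IsCompleteOrder (FGLattice A (A × A)))
    {J : Submodule A A} (g : J →ₗ[A] A) (hg : Function.Injective g) :
    ∃ f : A →ₗ[A] A, ∀ x : J, f x = g x := by
  let G := LinearMap.range (J.subtype.prod g)
  have hG := G.fg_fgClosure h2
  -- `T` is the fibre of the closed graph over `0`. It lies in the closure of `range g`, so showing
  -- that it misses `range g` makes it zero.
  let T : Submodule A A := G.fgClosure.comap (LinearMap.inr A A A)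
  have hT : T.FG := by
    refine Submodule.fg_of_fg_map_injective (LinearMap.inr A A A) LinearMap.inr_injective ?_
    rw [Submodule.map_comap_eq]
    exact (hA.prod hA).fg_inf (Submodule.fg_range _) hG
  have hTle : T ≤ (LinearMap.range g).fgClosure := by
    have : G.fgClosure ≤ (⊤ : Submodule A A).prod (LinearMap.range g).fgClosure := by
      refine Submodule.fgClosure_le
        (Submodule.FG.prod Module.Finite.fg_top (Submodule.fg_fgClosure h.complete _)) ?_
      rintro _ ⟨x, rfl⟩
      exact ⟨trivial, Submodule.le_fgClosure _ ⟨x, rfl⟩⟩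
    exact fun t ht => (this ht).2
  have hTg : Disjoint T (LinearMap.range g) := by
    rw [Submodule.disjoint_def]
    rintro _ ht ⟨j, rfl⟩
    obtain ⟨ψ, hψ⟩ := hA (j : A)
    let q : A →ₗ[A] J := LinearMap.toSpanSingleton A J j ∘ₗ ψ
    have hqj : q j = j := Subtype.ext (by simpa [q] using hψ)
    have hqq (x : A) : q (q x) = q x := by
      have hq : q x = ψ x • j := rfl
      rw [hq, Submodule.coe_smul, map_smul, hqj]
    -- Split `j` off with the idempotent `q`: after the shear by `g ∘ q`, the graph has second
    -- coordinates in `V`. Hence `g j ∈ T` lies in the closure of `V`, although injectivity of `g`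
    -- makes `A ∙ g j` miss `V`.
    let V : Submodule A A := (LinearMap.ker (q ∘ₗ J.subtype)).map g
    have hB : G.fgClosure ≤ ((⊤ : Submodule A A).prod V.fgClosure).map
        (LinearMap.prod (LinearMap.fst A A A)
          (LinearMap.snd A A A + g ∘ₗ q ∘ₗ LinearMap.fst A A A)) := by
      refine Submodule.fgClosure_le ((Submodule.FG.prod Module.Finite.fg_top
        (Submodule.fg_fgClosure h.complete _)).map _) ?_
      rintro _ ⟨x, rfl⟩
      refine ⟨(x, g (x - q x)), ⟨trivial, V.le_fgClosure ⟨x - q x, ?_, rfl⟩⟩, ?_⟩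
      · rw [SetLike.mem_coe, LinearMap.mem_ker, map_sub, sub_eq_zero]
        exact (hqq x).symm
      · simp
    obtain ⟨⟨x, y⟩, ⟨-, hy⟩, hxy⟩ := hB ht
    obtain ⟨rfl, hy'⟩ : x = 0 ∧ y + g (q x) = g j := by simpa using hxy
    have hyj : g j ∈ V.fgClosure := by
      rw [← hy', map_zero, map_zero, add_zero]; exact hy
    have hdis : Disjoint (A ∙ g j) V := by
      rw [Submodule.disjoint_def]
      rintro _ hr ⟨y, hy0, hyr⟩
      obtain ⟨r, rfl⟩ := Submodule.mem_span_singleton.1 hr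
      have hyj : y = r • j := hg (by rw [hyr, map_smul])
      have : q y = y := by rw [hyj, Submodule.coe_smul, map_smul, hqj]
      rw [← hyr, ← this, show q y = 0 from hy0, map_zero]
    exact Submodule.disjoint_def.1
      (hA.disjoint_fgClosure h V (Submodule.fg_span_singleton (g j)) hdis) _
      (Submodule.mem_span_singleton_self _) hyj
  have hT0 : T = ⊥ := by
    have := hA.disjoint_fgClosure h _ hT hTg
    exact le_bot_iff.1 (this le_rfl hTle)
  obtain ⟨f, hf⟩ := hA.exists_graph_le hG fun t ht => by
    have : t ∈ T := ht
    simpa [hT0] using this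
  exact ⟨f, fun x => hf _ (G.le_fgClosure ⟨x, rfl⟩)⟩

theorem IsRegularModule.baer_of_isUpperContinuous (hA : IsRegularModule A A)
    (h : IsUpperContinuous (FGLattice A A)) (h2 : IsCompleteOrder (FGLattice A (A × A))) :
    Module.Baer A A := by
  intro J g
  obtain ⟨C, hC⟩ := (LinearMap.ker g).exists_maximal_disjoint
  let K' : Submodule A A := (LinearMap.ker g).map J.subtype
  let C' : Submodule A A := C.map J.subtype
  have hdKC : Disjoint K' C' := (Submodule.disjoint_map J.injective_subtype) hC.prop
  have hCK : Disjoint C' K'.fgClosure := by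
    rw [Submodule.disjoint_def]
    intro x hx hxK
    -- `C'` need not be finitely generated, so the lemma is applied to cyclic submodules first;
    -- applying it again, to the closure of `K'`, separates both closures.
    have := hA.disjoint_fgClosure h K' (Submodule.fg_span_singleton x)
      (hdKC.symm.mono_left ((Submodule.span_singleton_le_iff_mem _ _).2 hx))
    exact Submodule.disjoint_def.1 this x (Submodule.mem_span_singleton_self x) hxK
  have hCK' : Disjoint C'.fgClosure K'.fgClosure :=
    (hA.disjoint_fgClosure h C' (K'.fg_fgClosure h.complete) hCK.symm).symm
  obtain ⟨p, hpC, hpK⟩ := hA.exists_proj_of_disjoint (C'.fg_fgClosure h.complete)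
    (K'.fg_fgClosure h.complete) hCK'
  let e := Submodule.equivMapOfInjective J.subtype J.injective_subtype C
  obtain ⟨f, hf⟩ := hA.exists_extension_of_injective h h2 (J := C')
    (g ∘ₗ C.subtype ∘ₗ e.symm.toLinearMap) (by
      refine Function.Injective.comp (g := g ∘ₗ C.subtype) ?_ e.symm.injective
      rw [← LinearMap.ker_eq_bot, LinearMap.ker_eq_bot']
      exact fun x hx => Subtype.ext (Submodule.disjoint_def.1 hC.prop x hx x.2))
  have hfC (x : J) (hx : x ∈ C) : f x = g x := by
    have h1 := hf (e ⟨x, hx⟩)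
    simpa [e] using h1
  -- `f ∘ p` agrees with `g` on `ker g ⊕ C`, which is essential in `J`.
  have h0 : (f ∘ₗ p) ∘ₗ J.subtype - g = 0 := by
    refine hA.eq_zero_of_essential _
      (fun Y hY => Submodule.eq_bot_of_maximal_disjoint hC Y hY) fun x hx => ?_
    obtain ⟨y, hy, z, hz, rfl⟩ := Submodule.mem_sup.1 hx
    have h1 : p y = 0 := hpK _ (K'.le_fgClosure ⟨y, hy, rfl⟩)
    have h2 : p z = z := hpC _ (C'.le_fgClosure ⟨z, hz, rfl⟩)
    have h3 : g y = 0 := hy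
    simp [h1, h2, h3, hfC z hz]
  exact ⟨f ∘ₗ p, fun x hx => sub_eq_zero.1 (LinearMap.congr_fun h0 ⟨x, hx⟩)⟩

theorem IsRegularModule.injective_tfae (hA : IsRegularModule A A) :
    List.TFAE [Module.Injective A A,
      ∀ n : ℕ, IsUpperContinuous (FGLattice A (Fin n → A)),
      IsUpperContinuous (FGLattice A (Fin 2 → A)),
      IsUpperContinuous (FGLattice A A) ∧ IsCompleteOrder (FGLattice A (Fin 2 → A))] := by
  have e : FGLattice A (Fin 2 → A) ≃o FGLattice A (A × A) :=
    FGLattice.congr (LinearEquiv.finTwoArrow A A)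
  tfae_have 1 → 2 := fun h n => (hA.pi_fin n).isUpperContinuous
  tfae_have 2 → 3 := fun h => h 2
  tfae_have 3 → 1 := fun h => (hA.baer_of_isUpperContinuous_prod (h.congr e)).injective
  tfae_have 1 → 4 := fun h => ⟨hA.isUpperContinuous, (hA.pi_fin 2).isUpperContinuous.complete⟩
  tfae_have 4 → 1 := fun h => (hA.baer_of_isUpperContinuous h.1 (h.2.congr e)).injective
  tfae_finish

end SelfInjective

/-! ### π-coherence from completeness -/

section PiCoherent

variable {A Q : Type*} [Ring A] [AddCommGroup Q] [Module A Q]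

/-- The relations among the generators of `N` are the intersection over `I` of the coordinate
kernels. Each of these is finitely generated by regularity, and completeness carries this over to
the intersection. -/
theorem IsRegularModule.finitePresentation_of_fg_pi (hQ : IsRegularModule A Q)
    (h : ∀ n : ℕ, IsCompleteOrder (FGLattice A (Fin n → A))) {I : Type*}
    (N : Submodule A (I → Q)) (hN : N.FG) : Module.FinitePresentation A N := by
  have := Module.Finite.iff_fg.2 hN
  obtain ⟨n, f, hf⟩ := Module.Finite.exists_fin' A N
  refine Module.finitePresentation_of_surjective f hf ?_
  have : LinearMap.ker f = sInf (Set.range fun i : I =>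
      LinearMap.ker (LinearMap.proj (φ := fun _ => Q) i ∘ₗ N.subtype ∘ₗ f)) := by
    rw [sInf_range]
    ext x
    rw [Submodule.mem_iInf, LinearMap.mem_ker, ← Submodule.coe_eq_zero, funext_iff]
    rfl
  rw [this]
  refine isCompleteOrder_fgLattice_iff.1 (h n) _ ?_
  rintro _ ⟨i, rfl⟩
  exact hQ.fg_ker _

end PiCoherent

/-! ### Annihilator duality between left and right submodules -/

section Duality

open MulOpposite

variable {R : Type u} [Ring R] {n : ℕ}

/-- The left linear form `v ↦ v ⬝ᵥ x`. -/
def dotProductLeft (x : Fin n → R) : (Fin n → R) →ₗ[R] R where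
  toFun v := v ⬝ᵥ x
  map_add' v w := add_dotProduct v w x
  map_smul' r v := smul_dotProduct r v x

/-- The right linear form `x ↦ v ⬝ᵥ x`. -/
def dotProductRight (v : Fin n → R) : (Fin n → R) →ₗ[Rᵐᵒᵖ] R where
  toFun x := v ⬝ᵥ x
  map_add' x y := dotProduct_add v x y
  map_smul' r x := dotProduct_smul r v x

/-- The left submodule of `Rⁿ` annihilating a right submodule. -/
def leftPerp (N : Submodule Rᵐᵒᵖ (Fin n → R)) : Submodule R (Fin n → R) :=
  ⨅ x ∈ N, LinearMap.ker (dotProductLeft x)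

/-- The right submodule of `Rⁿ` annihilated by a left submodule. -/
def rightPerp (N : Submodule R (Fin n → R)) : Submodule Rᵐᵒᵖ (Fin n → R) :=
  ⨅ v ∈ N, LinearMap.ker (dotProductRight v)

theorem mem_leftPerp {N : Submodule Rᵐᵒᵖ (Fin n → R)} {v : Fin n → R} :
    v ∈ leftPerp N ↔ ∀ x ∈ N, v ⬝ᵥ x = 0 := by
  simp [leftPerp, dotProductLeft]

theorem mem_rightPerp {N : Submodule R (Fin n → R)} {x : Fin n → R} :
    x ∈ rightPerp N ↔ ∀ v ∈ N, v ⬝ᵥ x = 0 := by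
  simp [rightPerp, dotProductRight]

theorem le_rightPerp_iff {N : Submodule Rᵐᵒᵖ (Fin n → R)} {K : Submodule R (Fin n → R)} :
    N ≤ rightPerp K ↔ K ≤ leftPerp N :=
  ⟨fun h _ hv => mem_leftPerp.2 fun _ hx => mem_rightPerp.1 (h hx) _ hv,
    fun h _ hx => mem_rightPerp.2 fun _ hv => mem_leftPerp.1 (h hv) _ hx⟩

theorem exists_eq_dotProductLeft (f : (Fin n → R) →ₗ[R] R) : ∃ x, f = dotProductLeft x := by
  refine ⟨fun i => f (Pi.single i 1), LinearMap.pi_ext' fun i => LinearMap.ext_ring ?_⟩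
  simp [dotProductLeft]

theorem exists_eq_dotProductRight (f : (Fin n → R) →ₗ[Rᵐᵒᵖ] R) : ∃ v, f = dotProductRight v := by
  refine ⟨fun i => f (Pi.single i 1), LinearMap.pi_ext fun i x => ?_⟩
  have : (Pi.single i x : Fin n → R) = op x • Pi.single i 1 := by
    rw [← Pi.single_smul]; simp
  rw [this, map_smul]
  simp [dotProductRight]

/-- The coordinates of `p - id`, for a projection `p` onto `N`, are dot products with vectors of
`leftPerp N`; a vector killed by all of them is fixed by `p`. -/
theorem rightPerp_leftPerp (h : IsRegularModule Rᵐᵒᵖ R) {N : Submodule Rᵐᵒᵖ (Fin n → R)}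
    (hN : N.FG) : rightPerp (leftPerp N) = N := by
  refine le_antisymm (fun x hx => ?_) (le_rightPerp_iff.2 le_rfl)
  obtain ⟨p, hp, hpN⟩ := (h.pi_fin n).exists_proj hN
  suffices p x = x from this ▸ hp x
  funext i
  obtain ⟨v, hv⟩ := exists_eq_dotProductRight (LinearMap.proj i ∘ₗ (p - LinearMap.id))
  have hvN : v ∈ leftPerp N := mem_leftPerp.2 fun y hy => by
    have := LinearMap.congr_fun hv y
    simpa [hpN y hy, dotProductRight] using this.symm
  have := LinearMap.congr_fun hv x
  rw [show dotProductRight v x = 0 from mem_rightPerp.1 hx v hvN] at this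
  exact sub_eq_zero.1 this

theorem leftPerp_rightPerp (h : IsRegularModule R R) {N : Submodule R (Fin n → R)}
    (hN : N.FG) : leftPerp (rightPerp N) = N := by
  refine le_antisymm (fun x hx => ?_) (le_rightPerp_iff.1 le_rfl)
  obtain ⟨p, hp, hpN⟩ := (h.pi_fin n).exists_proj hN
  suffices p x = x from this ▸ hp x
  funext i
  obtain ⟨v, hv⟩ := exists_eq_dotProductLeft (LinearMap.proj i ∘ₗ (p - LinearMap.id))
  have hvN : v ∈ rightPerp N := mem_rightPerp.2 fun y hy => by
    have := LinearMap.congr_fun hv y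
    simpa [hpN y hy, dotProductLeft] using this.symm
  have := LinearMap.congr_fun hv x
  rw [show dotProductLeft v x = 0 from mem_leftPerp.1 hx v hvN] at this
  exact sub_eq_zero.1 this

/-- Annihilating `m` generators is the kernel of one map `Rⁿ → Rᵐ`. -/
theorem fg_leftPerp (h : IsRegularModule R R) {N : Submodule Rᵐᵒᵖ (Fin n → R)} (hN : N.FG) :
    (leftPerp N).FG := by
  obtain ⟨m, s, rfl⟩ := Submodule.fg_iff_exists_fin_generating_family.1 hN
  have key : leftPerp (Submodule.span Rᵐᵒᵖ (Set.range s)) =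
      LinearMap.ker (LinearMap.pi fun i => dotProductLeft (s i)) := by
    ext v
    rw [LinearMap.mem_ker, funext_iff]
    refine mem_leftPerp.trans ?_
    change Submodule.span Rᵐᵒᵖ (Set.range s) ≤ LinearMap.ker (dotProductRight v) ↔ _
    rw [Submodule.span_le, Set.range_subset_iff]
    rfl
  rw [key]
  exact (h.pi_fin m).fg_ker _

theorem fg_rightPerp [Module.Finite Rᵐᵒᵖ R] (h : IsRegularModule Rᵐᵒᵖ R)
    {N : Submodule R (Fin n → R)} (hN : N.FG) : (rightPerp N).FG := by
  obtain ⟨m, s, rfl⟩ := Submodule.fg_iff_exists_fin_generating_family.1 hN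
  have key : rightPerp (Submodule.span R (Set.range s)) =
      LinearMap.ker (LinearMap.pi fun i => dotProductRight (s i)) := by
    ext v
    rw [LinearMap.mem_ker, funext_iff]
    refine mem_rightPerp.trans ?_
    change Submodule.span R (Set.range s) ≤ LinearMap.ker (dotProductLeft v) ↔ _
    rw [Submodule.span_le, Set.range_subset_iff]
    rfl
  rw [key]
  exact (h.pi_fin m).fg_ker _

/-- Annihilators give an anti-isomorphism between the posets of finitely generated right and left
submodules of `Rⁿ`. -/
def FGLattice.perp [Module.Finite Rᵐᵒᵖ R] (h : IsRegularModule R R) (h' : IsRegularModule Rᵐᵒᵖ R)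
    (n : ℕ) : FGLattice Rᵐᵒᵖ (Fin n → R) ≃o (FGLattice R (Fin n → R))ᵒᵈ where
  toFun N := OrderDual.toDual ⟨leftPerp N.1, fg_leftPerp h N.2⟩
  invFun N := ⟨rightPerp (OrderDual.ofDual N).1, fg_rightPerp h' (OrderDual.ofDual N).2⟩
  left_inv N := Subtype.ext (rightPerp_leftPerp h' N.2)
  right_inv N := Subtype.ext (leftPerp_rightPerp h (OrderDual.ofDual N).2)
  map_rel_iff' := by
    intro N K
    change leftPerp K.1 ≤ leftPerp N.1 ↔ N.1 ≤ K.1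
    rw [← le_rightPerp_iff, rightPerp_leftPerp h' K.2]

theorem isLowerContinuous_iff_of_dual {α β : Type*} [PartialOrder α] [PartialOrder β]
    (e : α ≃o βᵒᵈ) : IsLowerContinuous α ↔ IsUpperContinuous β :=
  ⟨fun h => isLowerContinuous_orderDual.1 (h.congr e),
    fun h => (isLowerContinuous_orderDual.2 h).congr e.symm⟩

theorem isCompleteOrder_iff_of_dual {α β : Type*} [PartialOrder α] [PartialOrder β]
    (e : α ≃o βᵒᵈ) : IsCompleteOrder α ↔ IsCompleteOrder β :=
  ⟨fun h => (h.congr e).dual, fun h => h.dual.congr e.symm⟩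

end Duality

/-! ### Assembly of the three parts -/

theorem isUpperContinuous_congr {α β : Type*} [PartialOrder α] [PartialOrder β]
    (e : α ≃o β) : IsUpperContinuous α ↔ IsUpperContinuous β :=
  ⟨fun h => h.congr e, fun h => h.congr e.symm⟩

theorem isCompleteOrder_congr {α β : Type*} [PartialOrder α] [PartialOrder β]
    (e : α ≃o β) : IsCompleteOrder α ↔ IsCompleteOrder β :=
  ⟨fun h => h.congr e, fun h => h.congr e.symm⟩

theorem IsVNRegular.op {R : Type u} [Ring R] (hR : IsVNRegular R) : IsVNRegular Rᵐᵒᵖ := by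
  intro a
  obtain ⟨x, hx⟩ := hR a.unop
  exact ⟨.op x, MulOpposite.unop_injective (by simpa [mul_assoc] using hx)⟩

theorem mainTheorem9 (R : Type u) [Ring R] (hR : IsVNRegular R) :
    List.TFAE
      [ IsRightSelfInjective R,
        ∀ n : ℕ, IsUpperContinuous (FGLattice Rᵐᵒᵖ (Fin n → R)),
        IsUpperContinuous (FGLattice Rᵐᵒᵖ (Fin 2 → R)),
        IsUpperContinuous (FGLattice Rᵐᵒᵖ R) ∧ IsCompleteOrder (FGLattice Rᵐᵒᵖ (Fin 2 → R)) ] ∧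
    List.TFAE
      [ IsLeftSelfInjective R,
        ∀ n : ℕ, IsUpperContinuous (FGLattice R (Fin n → R)),
        IsUpperContinuous (FGLattice R (Fin 2 → R)),
        IsUpperContinuous (FGLattice R R) ∧ IsCompleteOrder (FGLattice R (Fin 2 → R)),
        ∀ n : ℕ, IsLowerContinuous (FGLattice Rᵐᵒᵖ (Fin n → R)),
        IsLowerContinuous (FGLattice Rᵐᵒᵖ (Fin 2 → R)),
        IsLowerContinuous (FGLattice Rᵐᵒᵖ R) ∧ IsCompleteOrder (FGLattice Rᵐᵒᵖ (Fin 2 → R)) ] ∧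
    (IsLeftSelfInjective R ∨ IsRightSelfInjective R →
      IsLeftPiCoherent.{u, v} R ∧ IsRightPiCoherent.{u, v} R) := by
  let e : R ≃ₗ[Rᵐᵒᵖ] Rᵐᵒᵖ := MulOpposite.opLinearEquiv Rᵐᵒᵖ
  let E (n : ℕ) : FGLattice Rᵐᵒᵖ (Fin n → R) ≃o FGLattice Rᵐᵒᵖ (Fin n → Rᵐᵒᵖ) :=
    FGLattice.congr (LinearEquiv.piCongrRight fun _ => e)
  have hl : IsRegularModule R R := IsVNRegular.isRegularModule hR
  have hop : IsRegularModule Rᵐᵒᵖ Rᵐᵒᵖ := IsVNRegular.isRegularModule hR.op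
  have hr : IsRegularModule Rᵐᵒᵖ R := hop.of_injective e.toLinearMap e.injective
  have : Module.Finite Rᵐᵒᵖ R := Module.Finite.equiv e.symm
  let D (n : ℕ) : FGLattice Rᵐᵒᵖ (Fin n → R) ≃o (FGLattice R (Fin n → R))ᵒᵈ :=
    FGLattice.perp hl hr n
  let D₁ : FGLattice Rᵐᵒᵖ R ≃o (FGLattice R R)ᵒᵈ :=
    (FGLattice.congr (LinearEquiv.funUnique (Fin 1) Rᵐᵒᵖ R).symm).trans
      ((D 1).trans (FGLattice.congr (LinearEquiv.funUnique (Fin 1) R R)).dual)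
  have hinj : IsRightSelfInjective R ↔ Module.Injective Rᵐᵒᵖ Rᵐᵒᵖ := by
    rw [IsRightSelfInjective, ← Module.Baer.iff_injective, ← Module.Baer.iff_injective,
      Module.Baer.congr e]
  have ha := hop.injective_tfae
  rw [← hinj, ← isUpperContinuous_congr (E 2), ← isCompleteOrder_congr (E 2),
    ← isUpperContinuous_congr (FGLattice.congr e)] at ha
  simp only [← isUpperContinuous_congr (E _)] at ha
  have hb := hl.injective_tfae
  refine ⟨ha, ?_, fun h => ?_⟩
  · simp only [isLowerContinuous_iff_of_dual (D _), isLowerContinuous_iff_of_dual D₁,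
      isCompleteOrder_iff_of_dual (D 2)]
    tfae_have 1 ↔ 2 := hb.out 0 1
    tfae_have 1 ↔ 3 := hb.out 0 2
    tfae_have 1 ↔ 4 := hb.out 0 3
    -- The preceding rewriting along the duality has already turned the lower continuity conditions
    -- into the left-hand ones.
    tfae_have 2 ↔ 5 := Iff.rfl
    tfae_have 3 ↔ 6 := Iff.rfl
    tfae_have 4 ↔ 7 := Iff.rfl
    tfae_finish
  -- Self-duality of completeness lets injectivity on either side serve both sides.
  · have hc (n : ℕ) : IsCompleteOrder (FGLattice R (Fin n → R)) := by
      rcases h with h | h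
      · have := (hb.out 0 1 :
          IsLeftSelfInjective R ↔ ∀ n : ℕ, IsUpperContinuous (FGLattice R (Fin n → R))).1 h
        exact (this n).complete
      · have := (ha.out 0 1 :
          IsRightSelfInjective R ↔ ∀ n : ℕ, IsUpperContinuous (FGLattice Rᵐᵒᵖ (Fin n → R))).1 h
        exact (isCompleteOrder_iff_of_dual (D n)).1 (this n).complete
    exact ⟨fun I N => hl.finitePresentation_of_fg_pi hc N,
      fun I N => hr.finitePresentation_of_fg_pi
        (fun n => ((isCompleteOrder_iff_of_dual (D n)).2 (hc n)).congr (E n)) N⟩
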